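/- A \emph{self-delimiting computer} is a partial computable function $C$ from finite bit strings (programs) to finite bit strings (outputs) whose domain (the set of programs that halt) is prefix-free: no halting program is a proper prefix of another halting program. A self-delimiting computer $U$ is \emph{universal} if for every self-delimiting computer $C$ there is a constant $c$ such that whenever $C(p)=x$ there is a program $q$ with $U(q)=x$ and $|q|\le |p|+c$, where $|p|$ is the size of $p$ in bits. Let $U$ be any universal self-delimiting computer. Then the series defining its halting probability \[ \Omega=\sum_{p\,:\,U(p)\text{ halts}} 2^{-|p|} \] converges, $0<\Omega<1$, and $\Omega$ is Borel normal in every base: for every integer $b\ge 2$, every $k\ge 0$ and every block $w=w_0\cdots w_{k-1}$ of $k$ base-$b$ digits, if $\Omega=0.d_0d_1d_2\ldots$ is the base-$b$ expansion of $\Omega$, then \[ \lim_{N\to\infty}\frac{\#\{\,0\le i<N : d_{i+j}=w_j \text{ for all } 0\le j<k\,\}}{N}=\frac1{b^k}. \] -/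

import Mathlib

/-- A self-delimiting computer: a partial computable function from programs (finite bit strings)
to outputs (finite bit strings), `C p` being defined exactly when the program `p` halts, such that
no halting program is a proper prefix of another one. -/
structure IsSelfDelimitingComputer (C : List Bool →. List Bool) : Prop where
  partrec : Partrec C
  prefixFree : ∀ p q : List Bool, (C p).Dom → (C q).Dom → p <+: q → p = q

/-- A universal (general-purpose) self-delimiting computer: it simulates every self-delimiting
computer `C` at the cost of at most a constant number of additional program bits, the constant
depending only on `C`. -/
structure IsUniversalComputer (U : List Bool →. List Bool) : Prop where
  selfDelimiting : IsSelfDelimitingComputer U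
  simulates : ∀ C : List Bool →. List Bool, IsSelfDelimitingComputer C →
    ∃ c : ℕ, ∀ p x : List Bool, x ∈ C p →
      ∃ q : List Bool, x ∈ U q ∧ q.length ≤ p.length + c

/-- The probability `1 / 2 ^ (size in bits of p)` of getting precisely the program `p` by
independent tosses of a fair coin, for each program `p` that halts on `U`. -/
noncomputable def programProbability (U : List Bool →. List Bool)
    (p : {p : List Bool // (U p).Dom}) : ℝ :=
  1 / 2 ^ p.1.length

/-- The halting probability `Ω = ∑ 1 / 2 ^ (size in bits of p)`, over all programs `p` that halt
on `U`. -/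
noncomputable def haltingProbability (U : List Bool →. List Bool) : ℝ :=
  ∑' p : {p : List Bool // (U p).Dom}, programProbability U p

/-- The number of starting positions `i < N` at which the block `w` of `k` digits occurs in the
infinite digit sequence `d` (overlapping occurrences are all counted). -/
def blockCount {b k : ℕ} (d : ℕ → Fin b) (w : Fin k → Fin b) (N : ℕ) : ℕ :=
  ((Finset.range N).filter fun i => ∀ j : Fin k, d (i + j) = w j).card

/-- `x ∈ [0, 1)` is `b`-normal: for every `k`, each of the `b ^ k` blocks of `k` successive digits
has limiting relative frequency `1 / b ^ k` in the base-`b` expansion of `x`. -/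
def IsNormalInBase (b : ℕ) [NeZero b] (x : ℝ) : Prop :=
  ∀ (k : ℕ) (w : Fin k → Fin b),
    Filter.Tendsto (fun N : ℕ => (blockCount (Real.digits x b) w N : ℝ) / (N : ℝ))
      Filter.atTop (nhds (1 / (b : ℝ) ^ k))

/-- `x ∈ [0, 1)` is Borel normal: it is `b`-normal for every base `b = 2, 3, 4, …` -/
def IsBorelNormal (x : ℝ) : Prop :=
  ∀ (b : ℕ) [NeZero b], 2 ≤ b → IsNormalInBase b x

/-! A computable lower bound for Ω cannot be too sharp. Let each program `p` of a prefix-free set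
compute a rational r < Ω. A machine can enumerate halting programs of `U` until their weight exceeds
r, then print a string that none of them printed. `U` must print it too, by a new program of at most
|p| + c bits, so Ω ≥ r + 2^(-|p|-c) (`exists_gain`).

For normality, take K/G slightly above 1/B. By a Chernoff bound at most 2^(lm) strings of Gm base-B
digits contain a digit v at least Km times, where 2^l is at most B^G/8
(`exists_large_deviation_constants`). If the fractional part of DΩ began with such a string, its
index, preceded by m in unary, would name it in (l+1)m + 1 bits, and the gain would exceed the
truncation error (`digitCount_floor_lt`). So v has upper frequency at most 1/B.

A block of k base-b digits is one base-b^k digit of b^r Ω, with r the position mod k. The counts of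
the b^k blocks add up to N, so the upper bounds alone force the limit. -/

/-! ### Kraft's inequality and convergence -/

theorem uniquelyDecodable_of_prefixFree {α : Type*} {S : Set (List α)} (hnil : [] ∉ S)
    (hS : ∀ p ∈ S, ∀ q ∈ S, p <+: q → p = q) : InformationTheory.UniquelyDecodable S := by
  intro L₁
  induction L₁ with
  | nil =>
    intro L₂ _ h₂ h
    cases L₂ with
    | nil => rfl
    | cons q L₂ =>
      simp only [List.flatten_nil, List.flatten_cons, List.nil_eq, List.append_eq_nil_iff] at h
      exact absurd (h₂ q (by simp)) (h.1 ▸ hnil)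
  | cons p L₁ ih =>
    intro L₂ h₁ h₂ h
    cases L₂ with
    | nil =>
      simp only [List.flatten_nil, List.flatten_cons, List.append_eq_nil_iff] at h
      exact absurd (h₁ p (by simp)) (h.1 ▸ hnil)
    | cons q L₂ =>
      simp only [List.flatten_cons] at h
      have hp := h₁ p (by simp)
      have hq := h₂ q (by simp)
      have hpq : p = q := by
        have h3 : p <+: q ++ L₂.flatten := h ▸ List.prefix_append _ _
        rcases List.prefix_or_prefix_of_prefix h3 (List.prefix_append q _) with h4 | h4
        · exact hS p hp q hq h4
        · exact (hS q hq p hp h4).symm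
      subst hpq
      rw [ih L₂ (fun w hw => h₁ w (by simp [hw])) (fun w hw => h₂ w (by simp [hw]))
        (List.append_cancel_left h)]

theorem kraft_sum_le_one {S : Finset (List Bool)}
    (hS : ∀ p ∈ S, ∀ q ∈ S, p <+: q → p = q) : ∑ p ∈ S, (1 : ℝ) / 2 ^ p.length ≤ 1 := by
  by_cases hnil : [] ∈ S
  · have : S = {[]} := by
      ext q
      simp only [Finset.mem_singleton]
      exact ⟨fun hq => (hS [] hnil q hq List.nil_prefix).symm, fun hq => hq ▸ hnil⟩
    simp [this]
  · have := InformationTheory.kraft_mcmillan_inequality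
      (uniquelyDecodable_of_prefixFree (S := (S : Set (List Bool))) (by simpa using hnil)
        (by simpa using hS))
    simpa using this

theorem IsSelfDelimitingComputer.sum_le_one {U : List Bool →. List Bool}
    (hU : IsSelfDelimitingComputer U) (F : Finset {p : List Bool // (U p).Dom}) :
    ∑ p ∈ F, programProbability U p ≤ 1 := by
  have := kraft_sum_le_one (S := F.map (Function.Embedding.subtype _)) (by
    intro p hp q hq
    simp only [Finset.mem_map, Function.Embedding.subtype_apply] at hp hq
    obtain ⟨p, -, rfl⟩ := hp
    obtain ⟨q, -, rfl⟩ := hq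
    exact hU.prefixFree _ _ p.2 q.2)
  simpa [programProbability] using this

theorem programProbability_nonneg (U : List Bool →. List Bool)
    (p : {p : List Bool // (U p).Dom}) : 0 ≤ programProbability U p := by
  unfold programProbability; positivity

theorem IsSelfDelimitingComputer.summable {U : List Bool →. List Bool}
    (hU : IsSelfDelimitingComputer U) : Summable (programProbability U) :=
  summable_of_sum_le (programProbability_nonneg U) hU.sum_le_one

theorem IsSelfDelimitingComputer.haltingProbability_le_one {U : List Bool →. List Bool}
    (hU : IsSelfDelimitingComputer U) : haltingProbability U ≤ 1 :=
  hU.summable.tsum_le_of_sum_le hU.sum_le_one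

theorem IsSelfDelimitingComputer.sum_le_haltingProbability {U : List Bool →. List Bool}
    (hU : IsSelfDelimitingComputer U) (S : Finset (List Bool)) (hS : ∀ p ∈ S, (U p).Dom) :
    ∑ p ∈ S, (1 : ℝ) / 2 ^ p.length ≤ haltingProbability U := by
  classical
  have h := hU.summable.sum_le_tsum (S.subtype fun p => (U p).Dom)
    (fun p _ => programProbability_nonneg U p)
  refine le_trans (le_of_eq ?_) h
  unfold programProbability
  rw [Finset.sum_subtype_of_mem (fun p : List Bool => (1 : ℝ) / 2 ^ p.length) hS]

/-! ### Enumeration in stages and the gain inequality -/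

theorem primrec_nat_pow : Primrec₂ ((· ^ ·) : ℕ → ℕ → ℕ) :=
  Primrec₂.unpaired'.1 Nat.Primrec.pow

/-- The graph of a partial recursive function is enumerated in stages by a primitive recursive
function. -/
theorem exists_stages {U : List Bool →. List Bool} (hU : Partrec U) :
    ∃ e : ℕ → List (List Bool × List Bool), Primrec e ∧
      (∀ s, ((e s).map Prod.fst).Nodup) ∧
      (∀ s, ∀ y ∈ e s, y.2 ∈ U y.1 ∧ y.1.length ≤ s) ∧
      ∀ p x, x ∈ U p → ∃ s₀, ∀ s, s₀ ≤ s → (p, x) ∈ e s := by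
  obtain ⟨c, hc⟩ := Nat.Partrec.Code.exists_code.1 hU
  have hceval : ∀ p y, y ∈ c.eval (Encodable.encode p) ↔ ∃ x ∈ U p, Encodable.encode x = y := by
    intro p y
    rw [hc]
    simp
  -- `decode₂` accepts only the code of `p` itself, so no program is listed twice.
  let g : ℕ → ℕ → Option (List Bool × List Bool) := fun s n =>
    (Encodable.decode₂ (List Bool) n).bind fun p =>
      (c.evaln s n).bind fun y => (Encodable.decode (α := List Bool) y).map fun x => (p, x)
  have hg : ∀ s n p x, g s n = some (p, x) ↔
      n = Encodable.encode p ∧ Encodable.encode x ∈ c.evaln s n := by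
    intro s n p x
    simp only [g, Option.bind_eq_some_iff, Option.map_eq_some_iff, Prod.mk.injEq]
    constructor
    · rintro ⟨p', hp, y, hy, x', hx, rfl, rfl⟩
      have hp' := Encodable.decode₂_eq_some.1 hp
      refine ⟨hp'.symm, ?_⟩
      have := Nat.Partrec.Code.evaln_sound hy
      rw [← hp', hceval] at this
      obtain ⟨x'', -, rfl⟩ := this
      simp only [Encodable.encodek, Option.some.injEq] at hx
      subst hx
      exact hy
    · rintro ⟨rfl, hy⟩
      exact ⟨p, by simp [Encodable.decode₂_encode], _, hy, x, by simp, rfl, rfl⟩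
  refine ⟨fun s => (List.range s).filterMap (g s), ?_, ?_, ?_, ?_⟩
  · refine Primrec.listFilterMap Primrec.list_range ?_
    refine Primrec.option_bind (Primrec.decode₂.comp Primrec.snd) ?_
    refine Primrec.option_bind (Nat.Partrec.Code.primrec_evaln.comp
      (((Primrec.fst.comp Primrec.fst).pair (Primrec.const c)).pair
        (Primrec.snd.comp Primrec.fst))) ?_
    refine Primrec.option_map (Primrec.decode.comp Primrec.snd) ?_
    exact ((Primrec.snd.comp (Primrec.fst.comp Primrec.fst)).pair Primrec.snd)
  · intro s
    rw [List.map_filterMap]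
    refine (List.nodup_range).filterMap ?_
    intro n n' p hn hn'
    simp only [Option.mem_def, Option.map_eq_some_iff, Prod.exists, exists_and_right,
      exists_eq_right] at hn hn'
    obtain ⟨x, hx⟩ := hn
    obtain ⟨x', hx'⟩ := hn'
    rw [((hg _ _ _ _).1 hx).1, ((hg _ _ _ _).1 hx').1]
  · rintro s ⟨p, x⟩ hy
    rw [List.mem_filterMap] at hy
    obtain ⟨n, hn, hy⟩ := hy
    obtain ⟨rfl, hx⟩ := (hg _ _ _ _).1 hy
    obtain ⟨x', hx', h⟩ := (hceval _ _).1 (Nat.Partrec.Code.evaln_sound hx)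
    rw [Encodable.encode_injective h] at hx'
    exact ⟨hx', (Encodable.length_le_encode p).trans (List.mem_range.1 hn).le⟩
  · intro p x hx
    obtain ⟨s₀, hs⟩ := Nat.Partrec.Code.evaln_complete.1 ((hceval p _).2 ⟨x, hx, rfl⟩)
    refine ⟨s₀, fun s h => List.mem_filterMap.2 ⟨Encodable.encode p, ?_, ?_⟩⟩
    · exact List.mem_range.2 ((Nat.Partrec.Code.evaln_bound hs).trans_le h)
    · exact (hg _ _ _ _).2 ⟨rfl, Nat.Partrec.Code.evaln_mono h hs⟩

/-- The total weight, in units of `2 ^ (-s)`, of the programs occurring in `l`. -/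
def stageWeight (s : ℕ) (l : List (List Bool × List Bool)) : ℕ :=
  l.foldr (fun y n => 2 ^ (s - y.1.length) + n) 0

/-- The length bound keeps the subtraction in the exponent from truncating. -/
theorem stageWeight_div {s : ℕ} {l : List (List Bool × List Bool)}
    (hl : ∀ y ∈ l, y.1.length ≤ s) (hn : (l.map Prod.fst).Nodup) :
    (stageWeight s l : ℝ) / 2 ^ s = ∑ p ∈ (l.map Prod.fst).toFinset, (1 : ℝ) / 2 ^ p.length := by
  rw [List.sum_toFinset _ hn]
  clear hn
  induction l with
  | nil => simp [stageWeight]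
  | cons y l ih =>
    have h1 : stageWeight s (y :: l) = 2 ^ (s - y.1.length) + stageWeight s l := rfl
    rw [List.map_cons, List.map_cons, List.sum_cons, ← ih fun z hz => hl z (by simp [hz]), h1]
    push_cast
    rw [add_div]
    congr 1
    rw [div_eq_div_iff (by positivity) (by positivity), ← pow_add, one_mul,
      Nat.sub_add_cancel (hl y (by simp))]

theorem primrec_stageWeight {e : ℕ → List (List Bool × List Bool)} (he : Primrec e) :
    Primrec fun s => stageWeight s (e s) := by
  refine Primrec.list_foldr (h := fun s z => 2 ^ (s - z.1.1.length) + z.2) he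
    (Primrec.const 0) ?_
  refine Primrec.nat_add.comp (primrec_nat_pow.comp (Primrec.const 2) ?_)
    (Primrec.snd.comp Primrec.snd)
  exact Primrec.nat_sub.comp Primrec.fst
    (Primrec.list_length.comp (Primrec.fst.comp (Primrec.fst.comp Primrec.snd)))

/-- A string longer than all outputs occurring in `l`. -/
def freshOutput (l : List (List Bool × List Bool)) : List Bool :=
  false :: (l.map Prod.snd).flatten

theorem freshOutput_ne {l : List (List Bool × List Bool)} {y : List Bool × List Bool}
    (hy : y ∈ l) : y.2 ≠ freshOutput l := by
  intro h
  have h1 : y.2.length ≤ (l.map Prod.snd).flatten.length :=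
    (List.sublist_flatten_of_mem (List.mem_map_of_mem hy)).length_le
  have h2 := congrArg List.length h
  simp only [freshOutput, List.length_cons] at h2
  omega

theorem primrec_freshOutput {e : ℕ → List (List Bool × List Bool)} (he : Primrec e) :
    Primrec fun s => freshOutput (e s) :=
  Primrec.list_cons.comp (Primrec.const false)
    (Primrec.list_flatten.comp (Primrec.list_map he (Primrec.snd.comp Primrec.snd)))

/-- Computably many prefix-free requests `A / B`, each one attached to a program `p`, force the
halting probability to leave the interval above `A / B` of length about `2 ^ (-|p|)`. -/
theorem IsUniversalComputer.exists_gain {U : List Bool →. List Bool} (hU : IsUniversalComputer U)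
    {t : List Bool → Option (ℕ × ℕ)} (ht : Computable t)
    (hpf : ∀ p q, (t p).isSome → (t q).isSome → p <+: q → p = q) :
    ∃ c : ℕ, ∀ p A B, t p = some (A, B) → 0 < B → (A : ℝ) / B < haltingProbability U →
      (A : ℝ) / B + 1 / 2 ^ (p.length + c) ≤ haltingProbability U := by
  obtain ⟨e, he, hnodup, hsound, hcomplete⟩ := exists_stages hU.selfDelimiting.partrec
  let C : List Bool →. List Bool := fun p =>
    ((t p : Part (ℕ × ℕ))).bind fun r =>
      (Nat.rfind fun s => (Part.some (decide (r.1 * 2 ^ s < stageWeight s (e s) * r.2)) :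
        Part Bool)).map fun s => freshOutput (e s)
  have hCdom : ∀ p, (C p).Dom → (t p).isSome := by
    intro p hp
    have h : (t p : Part (ℕ × ℕ)).Dom := hp.1
    simpa using h
  have hC : IsSelfDelimitingComputer C := by
    refine ⟨?_, fun p q hp hq => hpf p q (hCdom p hp) (hCdom q hq)⟩
    refine Partrec.bind ht.ofOption ?_
    refine Partrec.map ?_ ((primrec_freshOutput he).to_comp.comp Computable.snd)
    refine Partrec.rfind ?_
    refine Computable.partrec (α := (List Bool × ℕ × ℕ) × ℕ) ?_
    refine Primrec.to_comp ?_
    refine PrimrecPred.decide ?_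
    refine Primrec.nat_lt.comp ?_ ?_
    · exact Primrec.nat_mul.comp (Primrec.fst.comp (Primrec.snd.comp Primrec.fst))
        (primrec_nat_pow.comp (Primrec.const 2) Primrec.snd)
    · exact Primrec.nat_mul.comp ((primrec_stageWeight he).comp Primrec.snd)
        (Primrec.snd.comp (Primrec.snd.comp Primrec.fst))
  obtain ⟨c, hc⟩ := hU.simulates C hC
  refine ⟨c, fun p A B hp hB hlt => ?_⟩
  have hweight : ∀ s, (stageWeight s (e s) : ℝ) / 2 ^ s =
      ∑ p ∈ ((e s).map Prod.fst).toFinset, (1 : ℝ) / 2 ^ p.length := fun s =>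
    stageWeight_div (fun y hy => (hsound s y hy).2) (hnodup s)
  have hcond : ∀ s, A * 2 ^ s < stageWeight s (e s) * B ↔
      (A : ℝ) / B < (stageWeight s (e s) : ℝ) / 2 ^ s := by
    intro s
    rw [div_lt_div_iff₀ (by exact_mod_cast hB) (by positivity)]
    exact_mod_cast Iff.rfl
  obtain ⟨s, hs⟩ : ∃ s, A * 2 ^ s < stageWeight s (e s) * B := by
    obtain ⟨F, hF⟩ := ((hU.selfDelimiting.summable.hasSum.eventually
      (lt_mem_nhds hlt))).exists
    have hs0 : ∀ q : {p : List Bool // (U p).Dom}, ∃ s₀, ∀ s, s₀ ≤ s →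
        q.1 ∈ (e s).map Prod.fst := fun q => by
      obtain ⟨s₀, h⟩ := hcomplete q.1 _ (Part.get_mem q.2)
      exact ⟨s₀, fun s hs => List.mem_map.2 ⟨_, h s hs, rfl⟩⟩
    choose σ hσ using hs0
    refine ⟨F.sup σ, (hcond _).2 (hF.trans_le ?_)⟩
    rw [hweight]
    have h1 : ∑ q ∈ F, programProbability U q =
        ∑ p ∈ F.map (Function.Embedding.subtype _), (1 : ℝ) / 2 ^ p.length := by
      simp [programProbability]
    rw [h1]
    refine Finset.sum_le_sum_of_subset_of_nonneg ?_ fun _ _ _ => by positivity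
    intro q hq
    simp only [Finset.mem_map, Function.Embedding.subtype_apply] at hq
    obtain ⟨q, hq, rfl⟩ := hq
    exact List.mem_toFinset.2 (hσ q _ (Finset.le_sup hq))
  -- The search may stop before `s`; only its stopping condition matters below.
  obtain ⟨s', hs', -⟩ := Nat.rfind_min'
    (p := fun s => decide (A * 2 ^ s < stageWeight s (e s) * B)) (m := s) (by simpa using hs)
  have hlt' : A * 2 ^ s' < stageWeight s' (e s') * B := by simpa using Nat.rfind_spec hs'
  obtain ⟨q, hq, hqlen⟩ := hc p (freshOutput (e s')) (by
    simp only [C, hp, Part.coe_some, Part.bind_some]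
    exact Part.mem_map _ hs')
  -- `U` is single-valued, so a listed `q` would have a listed output, not the fresh one.
  have hqnew : q ∉ ((e s').map Prod.fst).toFinset := by
    intro h
    obtain ⟨⟨q', x⟩, hy, rfl⟩ := List.mem_map.1 (List.mem_toFinset.1 h)
    exact freshOutput_ne hy (Part.mem_unique (hsound _ _ hy).1 hq)
  have hsum := hU.selfDelimiting.sum_le_haltingProbability
    (insert q ((e s').map Prod.fst).toFinset) (by
      intro r hr
      rcases Finset.mem_insert.1 hr with rfl | hr
      · exact Part.dom_iff_mem.2 ⟨_, hq⟩
      · obtain ⟨y, hy, rfl⟩ := List.mem_map.1 (List.mem_toFinset.1 hr)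
        exact Part.dom_iff_mem.2 ⟨_, (hsound _ _ hy).1⟩)
  rw [Finset.sum_insert hqnew, ← hweight] at hsum
  have h2 := (hcond s').1 hlt'
  have h3 : (1 : ℝ) / 2 ^ (p.length + c) ≤ 1 / 2 ^ q.length :=
    one_div_le_one_div_of_le (by positivity) (pow_le_pow_right₀ (by norm_num) hqlen)
  linarith

/-! ### Requests with a unary header -/

/-- The natural number with binary expansion `p`. -/
def binaryValue (p : List Bool) : ℕ :=
  p.foldl (fun n b => 2 * n + b.toNat) 0

theorem exists_foldl_binary_eq (n : ℕ) :
    ∀ i < 2 ^ n, ∃ s : List Bool, s.length = n ∧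
      ∀ z, s.foldl (fun n b => 2 * n + b.toNat) z = z * 2 ^ n + i := by
  induction n with
  | zero =>
    intro i hi
    exact ⟨[], rfl, fun z => by simp at hi; simp [hi]⟩
  | succ n ih =>
    intro i hi
    obtain ⟨s, hs, h⟩ := ih (i / 2) (by omega)
    refine ⟨s ++ [decide (i % 2 = 1)], by simp [hs], fun z => ?_⟩
    rw [List.foldl_append, h]
    rcases Nat.mod_two_eq_zero_or_one i with h2 | h2 <;> simp [h2, pow_succ] <;> grind

theorem primrec_binaryValue : Primrec binaryValue := by
  refine Primrec.list_foldl (h := fun _ (z : ℕ × Bool) => 2 * z.1 + z.2.toNat) Primrec.id (Primrec.const 0) ?_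
  exact Primrec.nat_add.comp (Primrec.nat_mul.comp (Primrec.const 2)
    (Primrec.fst.comp Primrec.snd))
    ((Primrec.dom_finite Bool.toNat).comp (Primrec.snd.comp Primrec.snd))

/-- The first `false` closes a header that determines the total length, and a prefix shares that
header. Without any `false`, `idxOf` would return the length, contradicting the equation. -/
theorem eq_of_prefix_of_length_eq {l : ℕ} {p q : List Bool}
    (hp : p.length = (l + 1) * p.idxOf false + 1) (hq : q.length = (l + 1) * q.idxOf false + 1)
    (h : p <+: q) : p = q := by
  have hmem : false ∈ p := by
    rw [← List.idxOf_lt_length_iff]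
    nlinarith [Nat.zero_le (l * p.idxOf false)]
  obtain ⟨r, rfl⟩ := h
  rw [List.idxOf_append_of_mem hmem, ← hp] at hq
  have : r = [] := by
    rw [List.length_append] at hq
    exact List.length_eq_zero_iff.1 (by omega)
  simp [this]

theorem IsUniversalComputer.exists_gain_unary {U : List Bool →. List Bool}
    (hU : IsUniversalComputer U) (l : ℕ) {f : ℕ → ℕ → Option (ℕ × ℕ)} (hf : Primrec₂ f) :
    ∃ c : ℕ, ∀ m i A B, i < 2 ^ (l * m) → f m i = some (A, B) → 0 < B →
      (A : ℝ) / B < haltingProbability U →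
      (A : ℝ) / B + 1 / 2 ^ ((l + 1) * m + c) ≤ haltingProbability U := by
  -- Format 1^m 0 s with |s| = lm; the reduction mod 2^(lm) removes the header from the value.
  let t : List Bool → Option (ℕ × ℕ) := fun p =>
    if p.length = (l + 1) * p.idxOf false + 1 then
      f (p.idxOf false) (binaryValue p % 2 ^ (l * p.idxOf false)) else none
  have hidx : Primrec fun p : List Bool => p.idxOf false :=
    Primrec.list_idxOf.comp (Primrec.const false) Primrec.id
  have ht : Primrec t := by
    refine Primrec.ite ?_ ?_ (Primrec.const none)
    · exact Primrec.eq.comp Primrec.list_length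
        (Primrec.succ.comp (Primrec.nat_mul.comp (Primrec.const (l + 1)) hidx))
    · exact hf.comp hidx (Primrec.nat_mod.comp primrec_binaryValue
        (primrec_nat_pow.comp (Primrec.const 2) (Primrec.nat_mul.comp (Primrec.const l) hidx)))
  have hdom : ∀ p, (t p).isSome → p.length = (l + 1) * p.idxOf false + 1 := by
    intro p hp
    by_contra h
    simp [t, h] at hp
  obtain ⟨c, hc⟩ := hU.exists_gain ht.to_comp
    fun p q hp hq h => eq_of_prefix_of_length_eq (hdom p hp) (hdom q hq) h
  refine ⟨c + 1, fun m i A B hi hfm hB hlt => ?_⟩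
  obtain ⟨s, hs, hval⟩ := exists_foldl_binary_eq (l * m) i hi
  have hm : (List.replicate m true ++ false :: s).idxOf false = m := by
    rw [List.idxOf_append_of_notMem (by simp)]
    simp
  have hlen : (List.replicate m true ++ false :: s).length = (l + 1) * m + 1 := by
    simp [hs]; ring
  have htp : t (List.replicate m true ++ false :: s) = some (A, B) := by
    simp only [t, hm, hlen, if_true, ← hfm]
    congr 1
    rw [binaryValue, List.foldl_append, List.foldl_cons, hval, Nat.mul_add_mod',
      Nat.mod_eq_of_lt hi]
  have := hc _ A B htp hB hlt
  rwa [hlen, show (l + 1) * m + 1 + c = (l + 1) * m + (c + 1) by ring] at this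

/-! ### Strict bounds on Ω -/

theorem IsUniversalComputer.haltingProbability_pos {U : List Bool →. List Bool}
    (hU : IsUniversalComputer U) : 0 < haltingProbability U := by
  have hC : IsSelfDelimitingComputer fun p =>
      ((if p = [] then some [] else none : Option (List Bool)) : Part (List Bool)) := by
    have hdom : ∀ p : List Bool, ((if p = [] then some [] else none : Option (List Bool)) :
        Part (List Bool)).Dom → p = [] := by
      intro p hp
      by_contra h
      simp [h] at hp
    refine ⟨Computable.ofOption ?_, fun p q hp hq _ => (hdom p hp).trans (hdom q hq).symm⟩
    exact (Primrec.ite (Primrec.eq.comp Primrec.id (Primrec.const [])) (Primrec.const _)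
      (Primrec.const _)).to_comp
  obtain ⟨c, hc⟩ := hU.simulates _ hC
  obtain ⟨q, hq, -⟩ := hc [] [] (by simp)
  have := hU.selfDelimiting.sum_le_haltingProbability {q} (by
    intro p hp
    rw [Finset.mem_singleton.1 hp]
    exact Part.dom_iff_mem.2 ⟨_, hq⟩)
  refine lt_of_lt_of_le ?_ this
  simp

theorem IsUniversalComputer.haltingProbability_lt_one {U : List Bool →. List Bool}
    (hU : IsUniversalComputer U) : haltingProbability U < 1 := by
  refine lt_of_le_of_ne hU.selfDelimiting.haltingProbability_le_one fun h => ?_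
  -- If Ω = 1, the gain 2^(-m-c) above 1 - 4^(-m) passes 1 once m > c.
  obtain ⟨c, hc⟩ := hU.exists_gain_unary 0 (f := fun m _ => some (4 ^ m - 1, 4 ^ m)) (by
    have h4 : Primrec fun z : ℕ × ℕ => 4 ^ z.1 :=
      primrec_nat_pow.comp (Primrec.const 4) Primrec.fst
    exact Primrec.option_some.comp ((Primrec.nat_sub.comp h4 (Primrec.const 1)).pair h4))
  have h4 : (0 : ℝ) < 4 ^ (c + 1) := by positivity
  have hA : ((4 ^ (c + 1) - 1 : ℕ) : ℝ) / ((4 ^ (c + 1) : ℕ) : ℝ) = 1 - 1 / 4 ^ (c + 1) := by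
    rw [Nat.cast_sub (Nat.one_le_pow _ _ (by norm_num))]
    push_cast
    field_simp
  have h1 := hc (c + 1) 0 _ _ (by simp) rfl (by positivity) (by
    rw [h, hA]
    have : (0 : ℝ) < 1 / 4 ^ (c + 1) := by positivity
    linarith)
  rw [h, hA] at h1
  have h2 : (1 : ℝ) / 4 ^ (c + 1) < 1 / 2 ^ ((0 + 1) * (c + 1) + c) := by
    refine one_div_lt_one_div_of_lt (by positivity) ?_
    rw [show (4 : ℝ) = 2 ^ 2 by norm_num, ← pow_mul]
    exact pow_lt_pow_right₀ (by norm_num) (by omega)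
  linarith

/-! ### Large deviations of digit counts -/

/-- The number of occurrences of the digit `v` among the last `T` base-`B` digits of `a`. -/
def digitCount (B v T a : ℕ) : ℕ :=
  ∑ j ∈ Finset.range T, if a / B ^ j % B = v then 1 else 0

theorem digitCount_succ (B v T a : ℕ) :
    digitCount B v (T + 1) a = digitCount B v T (a / B) + if a % B = v then 1 else 0 := by
  rw [digitCount, Finset.sum_range_succ', digitCount]
  simp [pow_succ', Nat.div_div_eq_div_mul]

theorem digitCount_mod (B v T a : ℕ) :
    digitCount B v T (a % B ^ T) = digitCount B v T a := by
  refine Finset.sum_congr rfl fun j hj => ?_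
  have hj := Finset.mem_range.1 hj
  obtain ⟨k, rfl⟩ := Nat.exists_eq_add_of_lt hj
  rw [show B ^ (j + k + 1) = B ^ j * B ^ (k + 1) by ring, Nat.mod_mul_right_div_self,
    Nat.mod_mod_of_dvd _ (dvd_pow_self B (by omega))]

theorem sum_range_mul_eq {M : Type*} [AddCommMonoid M] (f : ℕ → M) (n B : ℕ) :
    ∑ a ∈ Finset.range (n * B), f a =
      ∑ i ∈ Finset.range n, ∑ r ∈ Finset.range B, f (B * i + r) := by
  induction n with
  | zero => simp
  | succ n ih => rw [Nat.succ_mul, Finset.sum_range_add, ih, Finset.sum_range_succ, mul_comm]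

/-- The generating function factors over the digits: each contributes x for `v` and 1 for each of
the other B - 1 values. -/
theorem sum_pow_digitCount {B v : ℕ} (hv : v < B) (x : ℝ) (T : ℕ) :
    ∑ a ∈ Finset.range (B ^ T), x ^ digitCount B v T a = (B - 1 + x) ^ T := by
  have hB : 0 < B := by omega
  induction T with
  | zero => simp [digitCount]
  | succ T ih =>
    have hdigit : ∑ r ∈ Finset.range B, x ^ (if r = v then 1 else 0) = (B - 1 + x : ℝ) := by
      rw [← Finset.add_sum_erase _ _ (Finset.mem_range.2 hv)]
      rw [Finset.sum_congr rfl (g := fun _ => (1 : ℝ)) fun r hr => by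
        simp [Finset.ne_of_mem_erase hr]]
      simp [Finset.card_erase_of_mem (Finset.mem_range.2 hv), Nat.cast_sub hB]
      ring
    rw [pow_succ, sum_range_mul_eq, pow_succ, ← ih, Finset.sum_mul]
    refine Finset.sum_congr rfl fun i _ => ?_
    rw [← hdigit, Finset.mul_sum]
    refine Finset.sum_congr rfl fun r hr => ?_
    have hr := Finset.mem_range.1 hr
    rw [digitCount_succ, Nat.mul_add_div hB, Nat.div_eq_of_lt hr, add_zero, Nat.mul_add_mod,
      Nat.mod_eq_of_lt hr, pow_add]

theorem card_filter_digitCount_mul_le {B v : ℕ} (hv : v < B) {x : ℝ} (hx : 1 ≤ x) (T n : ℕ) :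
    (((Finset.range (B ^ T)).filter fun a => n ≤ digitCount B v T a).card : ℝ) * x ^ n ≤
      (B - 1 + x) ^ T := by
  rw [← sum_pow_digitCount hv, ← nsmul_eq_mul, ← Finset.sum_const]
  calc _ ≤ ∑ a ∈ (Finset.range (B ^ T)).filter fun a => n ≤ digitCount B v T a,
        x ^ digitCount B v T a :=
        Finset.sum_le_sum fun a ha => pow_le_pow_right₀ hx (Finset.mem_filter.1 ha).2
    _ ≤ _ := Finset.sum_le_sum_of_subset_of_nonneg (Finset.filter_subset _ _)
        fun _ _ _ => by positivity

/-- Chernoff's bound with tilt x = e^ε. The factor 8 leaves three spare bits per unit of m, to pay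
for the unary header and the constants. -/
theorem exists_large_deviation_constants {B : ℕ} (hB : 2 ≤ B) {ε : ℝ} (hε : 0 < ε) (hε1 : ε ≤ 1) :
    ∃ (G K l : ℕ) (x : ℝ), 0 < G ∧ 1 ≤ x ∧ ((B : ℝ) - 1 + x) ^ G ≤ 2 ^ l * x ^ K ∧
      8 * 2 ^ l ≤ B ^ G ∧ (K : ℝ) ≤ G * (1 / B + 2 * ε) := by
  have hB0 : (2 : ℝ) ≤ B := by exact_mod_cast hB
  -- Gε ≥ 1 absorbs the ceiling in K; Gε²/2 ≥ log 16 covers rounding B^G down to 2^l, where B^G < 16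
  -- · 2^l.
  obtain ⟨G, hG⟩ := exists_nat_ge (max (1 / ε) (2 * Real.log 16 / ε ^ 2))
  have hG1 : 1 ≤ G * ε := by
    have := (le_max_left _ _).trans hG
    rwa [div_le_iff₀ hε] at this
  have hG2 : 2 * Real.log 16 ≤ G * ε ^ 2 := by
    have := (le_max_right _ _).trans hG
    rwa [div_le_iff₀ (by positivity)] at this
  have hGpos : 0 < G := by
    rcases Nat.eq_zero_or_pos G with h | h
    · simp [h] at hG1; linarith
    · exact h
  have hG16 : (16 : ℝ) ≤ (B : ℝ) ^ G := by
    have h1 : Real.log 16 = 4 * Real.log 2 := by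
      rw [show (16 : ℝ) = 2 ^ 4 by norm_num, Real.log_pow]; norm_num
    have h2 : (4 : ℝ) ≤ G := by
      have := Real.log_two_gt_d9
      have h3 : (G : ℝ) * ε ^ 2 ≤ G * 1 := by
        gcongr; nlinarith
      linarith
    calc (16 : ℝ) = 2 ^ 4 := by norm_num
      _ ≤ 2 ^ G := pow_le_pow_right₀ (by norm_num) (by exact_mod_cast h2)
      _ ≤ _ := by gcongr
  have hdiv : B ^ G / 8 ≠ 0 := by
    have : 16 ≤ B ^ G := by exact_mod_cast hG16
    omega
  have hl1 : 8 * 2 ^ Nat.log 2 (B ^ G / 8) ≤ B ^ G := by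
    have := Nat.pow_log_le_self 2 hdiv
    omega
  have hl2 : B ^ G < 16 * 2 ^ Nat.log 2 (B ^ G / 8) := by
    have := Nat.lt_pow_succ_log_self (b := 2) (by norm_num) (B ^ G / 8)
    rw [pow_succ] at this
    omega
  refine ⟨G, ⌈(G : ℝ) * (1 / B + ε)⌉₊, Nat.log 2 (B ^ G / 8), Real.exp ε, hGpos,
    Real.one_le_exp hε.le, ?_, hl1, ?_⟩
  · have hexp : Real.exp ε - 1 ≤ ε + ε ^ 2 := by
      have := Real.abs_exp_sub_one_sub_id_le (x := ε) (by rwa [abs_of_pos hε])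
      have := (abs_le.1 this).2
      linarith
    have h1 : (B : ℝ) - 1 + Real.exp ε ≤ B * Real.exp ((ε + ε ^ 2) / B) := by
      have := Real.add_one_le_exp ((ε + ε ^ 2) / B)
      calc (B : ℝ) - 1 + Real.exp ε ≤ B * ((ε + ε ^ 2) / B + 1) := by
            field_simp; linarith
        _ ≤ _ := by gcongr
    have h2 : ((B : ℝ) - 1 + Real.exp ε) ^ G ≤ B ^ G * Real.exp (G * ((ε + ε ^ 2) / B)) := by
      have h0 : 0 ≤ (B : ℝ) - 1 + Real.exp ε := by
        have := Real.exp_pos ε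
        linarith
      calc _ ≤ (B * Real.exp ((ε + ε ^ 2) / B)) ^ G := by gcongr
        _ = _ := by rw [mul_pow, ← Real.exp_nat_mul]
    have h3 : (G : ℝ) * ((ε + ε ^ 2) / B) + Real.log 16 ≤
        ⌈(G : ℝ) * (1 / B + ε)⌉₊ * ε := by
      have h4 := Nat.le_ceil ((G : ℝ) * (1 / B + ε))
      have h5 : (1 : ℝ) / B ≤ 1 / 2 := one_div_le_one_div_of_le (by norm_num) hB0
      have h6 : (G : ℝ) * ε ^ 2 * (1 / B) ≤ G * ε ^ 2 * (1 / 2) := by gcongr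
      have h7 : (G : ℝ) * (1 / B + ε) * ε ≤ ⌈(G : ℝ) * (1 / B + ε)⌉₊ * ε := by gcongr
      have h8 : (G : ℝ) * ((ε + ε ^ 2) / B) = G * ε * (1 / B) + G * ε ^ 2 * (1 / B) := by ring
      nlinarith
    have h9 : Real.exp (G * ((ε + ε ^ 2) / B)) * 16 ≤
        Real.exp ε ^ ⌈(G : ℝ) * (1 / B + ε)⌉₊ := by
      calc _ = Real.exp (G * ((ε + ε ^ 2) / B) + Real.log 16) := by
            rw [Real.exp_add, Real.exp_log (by norm_num)]
        _ ≤ Real.exp (⌈(G : ℝ) * (1 / B + ε)⌉₊ * ε) := Real.exp_le_exp.2 h3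
        _ = _ := by rw [Real.exp_nat_mul]
    have h10 : (B : ℝ) ^ G ≤ 16 * 2 ^ Nat.log 2 (B ^ G / 8) := by exact_mod_cast hl2.le
    calc _ ≤ (B : ℝ) ^ G * Real.exp (G * ((ε + ε ^ 2) / B)) := h2
      _ ≤ (16 * 2 ^ Nat.log 2 (B ^ G / 8)) * Real.exp (G * ((ε + ε ^ 2) / B)) := by gcongr
      _ = 2 ^ Nat.log 2 (B ^ G / 8) * (Real.exp (G * ((ε + ε ^ 2) / B)) * 16) := by ring
      _ ≤ _ := by gcongr
  · have := (Nat.ceil_lt_add_one (a := (G : ℝ) * (1 / B + ε)) (by positivity)).le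
    linarith

/-! ### Computability and size of the exceptional lists -/

theorem primrec_sum_range {α : Type*} [Primcodable α] {n : α → ℕ} {f : α → ℕ → ℕ}
    (hn : Primrec n) (hf : Primrec₂ f) :
    Primrec fun a => ∑ j ∈ Finset.range (n a), f a j := by
  refine (Primrec.nat_rec' (h := fun a (z : ℕ × ℕ) => z.2 + f a z.1) hn (Primrec.const 0)
    (Primrec.nat_add.comp (Primrec.snd.comp Primrec.snd)
      (hf.comp Primrec.fst (Primrec.fst.comp Primrec.snd)))).of_eq fun a => ?_
  induction n a with
  | zero => rfl
  | succ k ih => rw [Finset.sum_range_succ, ← ih]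

theorem primrec_digitCount (B v : ℕ) : Primrec₂ (digitCount B v) := by
  refine primrec_sum_range Primrec.fst ?_
  refine Primrec.ite ?_ (Primrec.const 1) (Primrec.const 0)
  exact Primrec.eq.comp (Primrec.nat_mod.comp (Primrec.nat_div.comp
    (Primrec.snd.comp Primrec.fst) (primrec_nat_pow.comp (Primrec.const B) Primrec.snd))
    (Primrec.const B)) (Primrec.const v)

/-- The numbers below `B ^ T` in which the digit `v` occurs at least `n` times. -/
def frequentList (B v T n : ℕ) : List ℕ :=
  (List.range (B ^ T)).filter fun a => n ≤ digitCount B v T a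

theorem mem_frequentList {B v T n a : ℕ} :
    a ∈ frequentList B v T n ↔ a < B ^ T ∧ n ≤ digitCount B v T a := by
  simp [frequentList]

theorem length_frequentList (B v T n : ℕ) : (frequentList B v T n).length =
    ((Finset.range (B ^ T)).filter fun a => n ≤ digitCount B v T a).card := by
  rw [frequentList, ← List.toFinset_card_of_nodup (List.nodup_range.filter _)]
  congr 1
  ext a
  simp

theorem primrec_frequentList (B v : ℕ) {g h : ℕ → ℕ} (hg : Primrec g) (hh : Primrec h) :
    Primrec fun m => frequentList B v (g m) (h m) := by
  refine (Primrec.listFilterMap (g := fun m a =>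
    if h m ≤ digitCount B v (g m) a then some a else none)
    (Primrec.list_range.comp (primrec_nat_pow.comp (Primrec.const B) hg)) ?_).of_eq fun m => ?_
  · refine Primrec.ite ?_ (Primrec.option_some.comp Primrec.snd) (Primrec.const none)
    exact Primrec.nat_le.comp (hh.comp Primrec.fst)
      ((primrec_digitCount B v).comp (hg.comp Primrec.fst) Primrec.snd)
  · rw [frequentList, ← List.filterMap_eq_filter]
    refine List.filterMap_congr fun a _ => ?_
    simp [Option.guard]

theorem length_frequentList_le {B v G K l : ℕ} {x : ℝ} (hv : v < B) (hx : 1 ≤ x)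
    (h : ((B : ℝ) - 1 + x) ^ G ≤ 2 ^ l * x ^ K) (m : ℕ) :
    (frequentList B v (G * m) (K * m)).length ≤ 2 ^ (l * m) := by
  have hB : (1 : ℝ) ≤ B := by exact_mod_cast (by omega : 1 ≤ B)
  have h1 := card_filter_digitCount_mul_le hv hx (G * m) (K * m)
  rw [← length_frequentList] at h1
  have h2 : ((B : ℝ) - 1 + x) ^ (G * m) ≤ 2 ^ (l * m) * x ^ (K * m) := by
    rw [pow_mul, pow_mul, pow_mul, ← mul_pow]
    exact pow_le_pow_left₀ (pow_nonneg (by linarith) _) h m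
  have h3 := le_of_mul_le_mul_right (h1.trans h2) (pow_pos (by linarith) _)
  exact_mod_cast h3

/-! ### Upper bounds for digit frequencies -/

theorem IsUniversalComputer.digitCount_floor_lt {U : List Bool →. List Bool}
    (hU : IsUniversalComputer U) {B D v G K l : ℕ} {x : ℝ} (hD : 0 < D) (hv : v < B)
    (hx : 1 ≤ x) (h : ((B : ℝ) - 1 + x) ^ G ≤ 2 ^ l * x ^ K) (hl : 8 * 2 ^ l ≤ B ^ G) :
    ∃ m₀, ∀ m, m₀ ≤ m →
      digitCount B v (G * m) ⌊haltingProbability U * D * B ^ (G * m)⌋₊ < K * m := by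
  have hpos := hU.haltingProbability_pos
  have hB : 0 < B := by omega
  set u := ⌊haltingProbability U * D⌋₊ with hu
  -- The integer part `u` is a hard-wired constant. The `- 1` makes the rational strictly smaller
  -- than Ω.
  obtain ⟨c, hc⟩ := hU.exists_gain_unary l (f := fun m i =>
    (frequentList B v (G * m) (K * m))[i]?.map fun a =>
      (u * B ^ (G * m) + a - 1, D * B ^ (G * m))) (by
    have hpow : Primrec fun z : (ℕ × ℕ) × ℕ => B ^ (G * z.1.1) :=
      primrec_nat_pow.comp (Primrec.const B) (Primrec.nat_mul.comp (Primrec.const G)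
        (Primrec.fst.comp Primrec.fst))
    refine Primrec.option_map (Primrec.list_getElem?.comp ((primrec_frequentList B v
      (Primrec.nat_mul.comp (Primrec.const G) Primrec.id)
      (Primrec.nat_mul.comp (Primrec.const K) Primrec.id)).comp Primrec.fst) Primrec.snd) ?_
    exact (Primrec.nat_sub.comp (Primrec.nat_add.comp (Primrec.nat_mul.comp (Primrec.const u) hpow)
      Primrec.snd) (Primrec.const 1)).pair (Primrec.nat_mul.comp (Primrec.const D) hpow))
  refine ⟨c + 1, fun m hm => ?_⟩
  by_contra! hcount
  set y := haltingProbability U * D * B ^ (G * m) with hy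
  have hDB : 0 < D * B ^ (G * m) := by positivity
  have hDB' : (0 : ℝ) < ((D * B ^ (G * m) : ℕ) : ℝ) := by exact_mod_cast hDB
  have hyeq : y = haltingProbability U * ((D * B ^ (G * m) : ℕ) : ℝ) := by
    rw [hy]; push_cast; ring
  have hypos : 0 < y := by rw [hyeq]; positivity
  have hdiv : ⌊y⌋₊ / B ^ (G * m) = u := by
    rw [← Nat.floor_div_natCast, hu, hy]
    push_cast
    rw [mul_div_cancel_right₀ _ (by positivity)]
  have hmem : ⌊y⌋₊ % B ^ (G * m) ∈ frequentList B v (G * m) (K * m) :=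
    mem_frequentList.2 ⟨Nat.mod_lt _ (by positivity), by rwa [digitCount_mod]⟩
  obtain ⟨i, hi⟩ := List.mem_iff_getElem?.1 hmem
  have hi' : i < 2 ^ (l * m) :=
    (List.getElem?_eq_some_iff.1 hi).1.trans_le (length_frequentList_le hv hx h m)
  have hrec : u * B ^ (G * m) + ⌊y⌋₊ % B ^ (G * m) = ⌊y⌋₊ := by
    rw [← hdiv, mul_comm]
    exact Nat.div_add_mod _ _
  have hfloor := Nat.floor_le hypos.le
  have hfloor' := Nat.lt_floor_add_one y
  have hpred : ((⌊y⌋₊ - 1 : ℕ) : ℝ) < y := by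
    rcases Nat.eq_zero_or_pos ⌊y⌋₊ with h0 | h0
    · simpa [h0] using hypos
    · rw [Nat.cast_sub h0]
      push_cast
      linarith
  have hgain := hc m i (⌊y⌋₊ - 1) (D * B ^ (G * m)) hi' (by
    simp only [hi, Option.map_some, hrec]) hDB (by
    rw [div_lt_iff₀ hDB', ← hyeq]
    exact hpred)
  -- The gain is at least two units 1/(D B^(Gm)), but ⌊y⌋ - 1 is less than two units below y.
  have hbig : 2 * 2 ^ ((l + 1) * m + c) ≤ D * B ^ (G * m) := by
    calc 2 * 2 ^ ((l + 1) * m + c) = 2 ^ ((l + 1) * m + c + 1) := by ring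
      _ ≤ 2 ^ ((3 + l) * m) := Nat.pow_le_pow_right (by norm_num) (by nlinarith)
      _ = (8 * 2 ^ l) ^ m := by rw [pow_mul, pow_add]; norm_num
      _ ≤ (B ^ G) ^ m := Nat.pow_le_pow_left hl m
      _ = 1 * B ^ (G * m) := by rw [pow_mul, one_mul]
      _ ≤ _ := Nat.mul_le_mul_right _ hD
  have hbig' : (2 : ℝ) / ((D * B ^ (G * m) : ℕ) : ℝ) ≤ 1 / 2 ^ ((l + 1) * m + c) := by
    rw [div_le_div_iff₀ hDB' (by positivity), one_mul]
    exact_mod_cast hbig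
  have h1 := (add_le_add_right hbig' _).trans hgain
  rw [← add_div, div_le_iff₀ hDB', ← hyeq] at h1
  have h2 : ⌊y⌋₊ ≤ ⌊y⌋₊ - 1 + 1 := by omega
  have h3 : ((⌊y⌋₊ : ℕ) : ℝ) ≤ ((⌊y⌋₊ - 1 : ℕ) : ℝ) + 1 := by exact_mod_cast h2
  linarith

theorem digitCount_floor {y : ℝ} {B : ℕ} (hB : 0 < B) (v T : ℕ) :
    digitCount B v T ⌊y * B ^ T⌋₊ =
      ∑ t ∈ Finset.range T, if ⌊y * B ^ (t + 1)⌋₊ % B = v then 1 else 0 := by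
  rw [← Finset.sum_range_reflect, digitCount]
  refine Finset.sum_congr rfl fun j hj => ?_
  have hj := Finset.mem_range.1 hj
  have : ⌊y * (B : ℝ) ^ T⌋₊ / B ^ j = ⌊y * (B : ℝ) ^ (T - 1 - j + 1)⌋₊ := by
    rw [← Nat.floor_div_natCast]
    push_cast
    have hT : T = T - 1 - j + 1 + j := by omega
    conv_lhs => rw [hT, pow_add, ← mul_assoc, mul_div_cancel_right₀ _ (by positivity)]
  rw [this]

theorem IsUniversalComputer.exists_digit_frequency_le {U : List Bool →. List Bool}
    (hU : IsUniversalComputer U) {B D v : ℕ} (hB : 2 ≤ B) (hD : 0 < D) (hv : v < B)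
    {ε : ℝ} (hε : 0 < ε) : ∃ C : ℝ, ∀ T : ℕ,
      ((∑ t ∈ Finset.range T,
        if ⌊haltingProbability U * D * B ^ (t + 1)⌋₊ % B = v then 1 else 0 : ℕ) : ℝ) ≤
      (1 / B + ε) * T + C := by
  obtain ⟨G, K, l, x, hG, hx, h, hl, hK⟩ := exists_large_deviation_constants hB
    (ε := min (ε / 2) 1) (by positivity) (min_le_right _ _)
  obtain ⟨m₀, hm₀⟩ := hU.digitCount_floor_lt hD hv hx h hl
  have hK' : (K : ℝ) ≤ G * (1 / B + ε) := by
    refine hK.trans ?_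
    have := min_le_left (ε / 2) 1
    gcongr
    linarith
  -- The first term pays for rounding T up to a multiple of G, the second for the small m where the
  -- bound may fail.
  refine ⟨(1 / B + ε) * G + G * m₀, fun T => ?_⟩
  have hG0 : (0 : ℝ) < G := by exact_mod_cast hG
  have hT : T ≤ G * (T / G + 1) := by
    have := Nat.lt_mul_div_succ T hG
    exact this.le
  rcases le_or_gt m₀ (T / G + 1) with hm | hm
  · have h1 := (hm₀ _ hm).le
    rw [digitCount_floor (by omega)] at h1
    have h2 := (Finset.sum_le_sum_of_subset (f := fun t =>
      if ⌊haltingProbability U * D * B ^ (t + 1)⌋₊ % B = v then 1 else 0)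
      (Finset.range_mono hT)).trans h1
    calc _ ≤ ((K * (T / G + 1) : ℕ) : ℝ) := by exact_mod_cast h2
      _ = K * ((T / G : ℕ) + 1) := by push_cast; ring
      _ ≤ (G * (1 / B + ε)) * (T / G + 1) := by
        gcongr
        exact Nat.cast_div_le
      _ = (1 / B + ε) * T + (1 / B + ε) * G := by field_simp
      _ ≤ _ := by
        have : (0 : ℝ) ≤ G * m₀ := by positivity
        linarith
  · have h1 : (∑ t ∈ Finset.range T,
        if ⌊haltingProbability U * D * B ^ (t + 1)⌋₊ % B = v then 1 else 0 : ℕ) ≤ T := by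
      refine (Finset.sum_le_card_nsmul _ _ 1 fun t _ => by split_ifs <;> simp).trans ?_
      simp
    have h2 : T ≤ G * m₀ := hT.trans (Nat.mul_le_mul_left _ hm.le)
    calc _ ≤ (T : ℝ) := by exact_mod_cast h1
      _ ≤ G * m₀ := by exact_mod_cast h2
      _ ≤ _ := by
        have : (0 : ℝ) ≤ (1 / B + ε) * T + (1 / B + ε) * G := by positivity
        linarith

/-! ### From digits in base b^k to blocks in base b -/

theorem digits_eq_iff {x : ℝ} {b : ℕ} [NeZero b] {i i' : ℕ} :
    Real.digits x b i = Real.digits x b i' ↔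
      ⌊x * b ^ (i + 1)⌋₊ % b = ⌊x * b ^ (i' + 1)⌋₊ % b := by
  rw [Fin.ext_iff]
  rfl

theorem floor_mul_pow_succ_div (x : ℝ) {b : ℕ} (hb : 0 < b) (n : ℕ) :
    ⌊x * b ^ (n + 1)⌋₊ / b = ⌊x * b ^ n⌋₊ := by
  rw [← Nat.floor_div_natCast, pow_succ, ← mul_assoc, mul_div_cancel_right₀ _ (by positivity)]

theorem floor_mod_eq_of_digits_eq {x : ℝ} {b : ℕ} [NeZero b] {i i' : ℕ} (k : ℕ)
    (h : ∀ j < k, Real.digits x b (i + j) = Real.digits x b (i' + j)) :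
    ⌊x * b ^ (i + k)⌋₊ % b ^ k = ⌊x * b ^ (i' + k)⌋₊ % b ^ k := by
  induction k with
  | zero => simp [Nat.mod_one]
  | succ k ih =>
    have hb := Nat.pos_of_ne_zero (NeZero.ne b)
    rw [pow_succ', Nat.mod_mul, Nat.mod_mul, ← add_assoc, ← add_assoc,
      floor_mul_pow_succ_div x hb, floor_mul_pow_succ_div x hb,
      ih fun j hj => h j (by omega), digits_eq_iff.1 (h k (by omega))]

/-- No formula for `v` is needed: any occurrence of `w` supplies it, and if there is none every
value works. -/
theorem exists_floor_mod_eq (x : ℝ) {b k : ℕ} [NeZero b] (w : Fin k → Fin b) :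
    ∃ v < b ^ k, ∀ i, (∀ j : Fin k, Real.digits x b (i + j) = w j) →
      ⌊x * b ^ (i + k)⌋₊ % b ^ k = v := by
  have hb := Nat.pos_of_ne_zero (NeZero.ne b)
  by_cases h : ∃ i, ∀ j : Fin k, Real.digits x b (i + j) = w j
  · obtain ⟨i₀, h₀⟩ := h
    refine ⟨_, Nat.mod_lt ⌊x * b ^ (i₀ + k)⌋₊ (by positivity), fun i hi => ?_⟩
    exact floor_mod_eq_of_digits_eq k fun j hj => (hi ⟨j, hj⟩).trans (h₀ ⟨j, hj⟩).symm
  · exact ⟨0, by positivity, fun i hi => absurd ⟨i, hi⟩ h⟩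

theorem blockCount_le {b k : ℕ} (d : ℕ → Fin b) (w : Fin k → Fin b) (N : ℕ) :
    blockCount d w N ≤ N :=
  (Finset.card_filter_le _ _).trans (by simp)

theorem sum_blockCount {b k : ℕ} (d : ℕ → Fin b) (N : ℕ) :
    ∑ w : Fin k → Fin b, blockCount d w N = N := by
  have := Finset.card_eq_sum_card_fiberwise (s := Finset.range N) (t := Finset.univ)
    (f := fun i => fun j : Fin k => d (i + j)) (fun _ _ => by simp)
  rw [Finset.card_range] at this
  conv_rhs => rw [this]
  refine Finset.sum_congr rfl fun w _ => ?_
  simp only [blockCount, funext_iff]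

theorem IsUniversalComputer.exists_blockCount_le {U : List Bool →. List Bool}
    (hU : IsUniversalComputer U) {b k : ℕ} [NeZero b] (hb : 2 ≤ b) (w : Fin k → Fin b)
    {ε : ℝ} (hε : 0 < ε) : ∃ C : ℝ, ∀ N : ℕ,
      (blockCount (Real.digits (haltingProbability U) b) w N : ℝ) ≤
        (1 / (b : ℝ) ^ k + ε) * N + C := by
  -- For k = 0 the base b^k would be 1, which the digit bound excludes.
  rcases Nat.eq_zero_or_pos k with rfl | hk
  · refine ⟨0, fun N => ?_⟩
    have h1 : (blockCount (Real.digits (haltingProbability U) b) w N : ℝ) ≤ N := by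
      exact_mod_cast blockCount_le _ w N
    have h2 : 0 ≤ ε * N := by positivity
    simp only [pow_zero, div_one, add_zero]
    linarith
  obtain ⟨v, hv, hval⟩ := exists_floor_mod_eq (haltingProbability U) w
  have hB : 2 ≤ b ^ k := hb.trans (Nat.le_self_pow hk.ne' b)
  have hfreq : ∀ r : ℕ, ∃ C : ℝ, ∀ T : ℕ, ((∑ t ∈ Finset.range T,
      if ⌊haltingProbability U * (b ^ r : ℕ) * (b ^ k : ℕ) ^ (t + 1)⌋₊ % b ^ k = v
        then 1 else 0 : ℕ) : ℝ) ≤ (1 / (b ^ k : ℕ) + ε) * T + C := fun r =>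
    hU.exists_digit_frequency_le hB (by positivity) hv hε
  choose C hC using hfreq
  refine ⟨(1 / (b : ℝ) ^ k + ε) * k + ∑ r ∈ Finset.range k, C r, fun N => ?_⟩
  have hN : N ≤ (N / k + 1) * k := by
    have := Nat.lt_mul_div_succ N hk
    rw [mul_comm]
    exact this.le
  -- Multiplication by b^r aligns the block at position kt + r with the base-b^k digit of index t.
  have hcount : blockCount (Real.digits (haltingProbability U) b) w N ≤
      ∑ r ∈ Finset.range k, ∑ t ∈ Finset.range (N / k + 1),
        if ⌊haltingProbability U * (b ^ r : ℕ) * (b ^ k : ℕ) ^ (t + 1)⌋₊ % b ^ k = v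
          then 1 else 0 := by
    rw [Finset.sum_comm, blockCount, Finset.card_filter]
    refine (Finset.sum_le_sum_of_subset (Finset.range_mono hN)).trans ?_
    rw [sum_range_mul_eq]
    refine Finset.sum_le_sum fun t _ => Finset.sum_le_sum fun r _ => ?_
    by_cases h : ∀ j : Fin k, Real.digits (haltingProbability U) b (k * t + r + j) = w j
    · have h1 := hval _ h
      rw [show haltingProbability U * (b : ℝ) ^ (k * t + r + k) =
        haltingProbability U * (b ^ r : ℕ) * (b ^ k : ℕ) ^ (t + 1) by push_cast; ring] at h1
      rw [if_pos h, if_pos h1]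
    · simp [h]
  calc _ ≤ ∑ r ∈ Finset.range k, ((∑ t ∈ Finset.range (N / k + 1),
        if ⌊haltingProbability U * (b ^ r : ℕ) * (b ^ k : ℕ) ^ (t + 1)⌋₊ % b ^ k = v
          then 1 else 0 : ℕ) : ℝ) := by exact_mod_cast hcount
    _ ≤ ∑ r ∈ Finset.range k, ((1 / (b : ℝ) ^ k + ε) * (N / k + 1) + C r) := by
      refine Finset.sum_le_sum fun r _ => (hC r _).trans ?_
      push_cast
      gcongr
      exact Nat.cast_div_le
    _ = _ := by
      have : (k : ℝ) ≠ 0 := by exact_mod_cast hk.ne'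
      rw [Finset.sum_add_distrib, Finset.sum_const, Finset.card_range, nsmul_eq_mul]
      field_simp
      ring

/-! ### The limit -/

theorem tendsto_div_of_abs_sub_le {f : ℕ → ℝ} {P : ℝ}
    (h : ∀ ε > 0, ∃ C : ℝ, ∀ N : ℕ, |f N - P * N| ≤ ε * N + C) :
    Filter.Tendsto (fun N : ℕ => f N / N) Filter.atTop (nhds P) := by
  rw [Metric.tendsto_atTop]
  intro ε hε
  obtain ⟨C, hC⟩ := h (ε / 2) (by positivity)
  obtain ⟨M, hM⟩ := exists_nat_gt (max 0 (2 * C / ε))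
  refine ⟨M, fun N hN => ?_⟩
  have hMN : (M : ℝ) ≤ N := by exact_mod_cast hN
  have hN0 : (0 : ℝ) < N := ((le_max_left _ _).trans_lt hM).trans_le hMN
  have hCN : 2 * C / ε < N := ((le_max_right _ _).trans_lt hM).trans_le hMN
  rw [div_lt_iff₀ hε] at hCN
  rw [Real.dist_eq, show f N / N - P = (f N - P * N) / N by field_simp, abs_div,
    abs_of_pos hN0, div_lt_iff₀ hN0]
  have := hC N
  linarith

theorem IsUniversalComputer.isNormalInBase {U : List Bool →. List Bool}
    (hU : IsUniversalComputer U) {b : ℕ} [NeZero b] (hb : 2 ≤ b) :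
    IsNormalInBase b (haltingProbability U) := by
  intro k w
  refine tendsto_div_of_abs_sub_le fun ε hε => ?_
  have hM : (0 : ℝ) < (b : ℝ) ^ k := by positivity
  have hM1 : (1 : ℝ) ≤ (b : ℝ) ^ k := one_le_pow₀ (by exact_mod_cast (by omega : 1 ≤ b))
  -- The lower bound for `w` adds the errors of the other b^k - 1 blocks, hence ε/b^k for each.
  have hup := fun w : Fin k → Fin b => hU.exists_blockCount_le hb w
    (ε := ε / (b : ℝ) ^ k) (by positivity)
  choose C hC using hup
  refine ⟨|C w| + |∑ w' ∈ Finset.univ.erase w, C w'|, fun N => ?_⟩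
  have hcard : ((Finset.univ.erase w).card : ℝ) = (b : ℝ) ^ k - 1 := by
    rw [Finset.card_erase_of_mem (Finset.mem_univ w), Finset.card_univ, Fintype.card_fun,
      Fintype.card_fin, Fintype.card_fin, Nat.cast_sub (Nat.one_le_pow _ _ (by omega))]
    push_cast
    ring
  have hsum : (blockCount (Real.digits (haltingProbability U) b) w N : ℝ) +
      ∑ w' ∈ Finset.univ.erase w,
        (blockCount (Real.digits (haltingProbability U) b) w' N : ℝ) = N := by
    rw [Finset.add_sum_erase _
      (fun w' => (blockCount (Real.digits (haltingProbability U) b) w' N : ℝ)) (Finset.mem_univ w)]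
    exact_mod_cast sum_blockCount (k := k) (Real.digits (haltingProbability U) b) N
  have hrest := Finset.sum_le_sum fun w' (_ : w' ∈ Finset.univ.erase w) => hC w' N
  rw [Finset.sum_add_distrib, Finset.sum_const, nsmul_eq_mul, hcard] at hrest
  have h0 := hC w N
  have hN : (0 : ℝ) ≤ N := by positivity
  have e1 : ((b : ℝ) ^ k - 1) * ((1 / (b : ℝ) ^ k + ε / (b : ℝ) ^ k) * N) =
      N - 1 / (b : ℝ) ^ k * N + ε * N - ε / (b : ℝ) ^ k * N := by
    field_simp
    ring
  have e2 : ε / (b : ℝ) ^ k * N ≤ ε * N := by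
    gcongr
    exact div_le_self hε.le hM1
  have e3 : 0 ≤ ε / (b : ℝ) ^ k * N := by positivity
  have a1 := le_abs_self (C w)
  have a2 := le_abs_self (∑ w' ∈ Finset.univ.erase w, C w')
  have a3 := abs_nonneg (C w)
  have a4 := abs_nonneg (∑ w' ∈ Finset.univ.erase w, C w')
  rw [abs_le]
  constructor <;> linarith

theorem mainTheorem6 (U : List Bool →. List Bool) (hU : IsUniversalComputer U) :
    Summable (programProbability U) ∧
      0 < haltingProbability U ∧ haltingProbability U < 1 ∧
      IsBorelNormal (haltingProbability U) :=
  ⟨hU.selfDelimiting.summable, hU.haltingProbability_pos, hU.haltingProbability_lt_one,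
    fun _ _ hb => hU.isNormalInBase hb⟩
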